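/- Let $K$ be an algebraically closed field, let $V=\bigoplus_{i=0}^n V^i$ be a graded $K$-vector space with all $V^i$ finite dimensional (regarded as a complex with zero differential, so that $V=H(V)$; put $V^{i}=0$ for $i>n$), and let $v_i=\dim_K V^i$. Let $r=(r_0,\dots,r_n)\in\mathbb{N}_0^{n+1}$ and put $r_{-1}=0$. Let $V[1]$ denote the shifted graded space, $V[1]^i=V^{i+1}$, and let $$\mathcal{D}_r=\Big\{d=(d^0,\dots,d^n)\in\prod_{i=0}^n \mathrm{Hom}_K(V^i,V^{i+1}) \;\Big|\; d^{i+1}d^i=0 \text{ for } 0\le i<n,\ \ \mathrm{rk}(d^i)=r_i \text{ for } 0\le i\le n\Big\}$$ be the set of differentials $d:V\to V[1]$ with $d^2=0$ and rank vector $r$. If $\mathcal{D}_r\neq\emptyset$, then $\mathcal{D}_r$ is a Zariski locally closed subset of the vector space $\prod_{i=0}^n \mathrm{Hom}_K(V^i,V^{i+1})$ which, as a variety (with its reduced structure), is smooth over $K$ and irreducible, and $$\dim\mathcal{D}_r=\sum_{i=0}^n (v_i+v_{i+1}-r_i-r_{i-1})\,r_i .$$ -/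

import Mathlib

/-! ### Classical algebraic geometry on a vector space -/

section Zariski

variable (K : Type*) [Field K] {W : Type*} [AddCommGroup W] [Module K W]

variable (W) in
/-- The algebra of polynomial functions on a `K`-vector space `W`: the `K`-algebra of functions
generated by the linear functionals. -/
def vectorSpacePolynomials : Subalgebra K (W → K) :=
  Algebra.adjoin K {f | ∃ φ : Module.Dual K W, f = fun w => φ w}

/-- A set is Zariski closed if it is the set of common zeros of a set of polynomial functions. -/
def IsZariskiClosed (Z : Set W) : Prop :=
  ∃ S ⊆ (vectorSpacePolynomials K W : Set (W → K)), Z = {w | ∀ f ∈ S, f w = 0}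

variable (W) in
/-- The Zariski topology of a `K`-vector space. -/
@[reducible] def zariskiTopology : TopologicalSpace W :=
  TopologicalSpace.ofClosed {Z | IsZariskiClosed K Z}
    ⟨{1}, by simp, by simp⟩
    (by
      intro A hA
      refine ⟨{f | f ∈ vectorSpacePolynomials K W ∧ ∃ Z ∈ A, ∀ w ∈ Z, f w = 0}, fun f hf => hf.1, ?_⟩
      ext w
      simp only [Set.mem_sInter, Set.mem_ofPred_eq]
      constructor
      · rintro h f ⟨-, Z, hZ, hf⟩
        exact hf w (h Z hZ)
      · intro h Z hZ
        obtain ⟨S, hS, hSZ⟩ := hA hZ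
        rw [hSZ]
        intro f hf
        refine h f ⟨hS hf, Z, hZ, fun w hw => ?_⟩
        rw [hSZ] at hw
        exact hw f hf)
    (by
      rintro _ ⟨S, hS, rfl⟩ _ ⟨T, hT, rfl⟩
      refine ⟨{h | ∃ f ∈ S, ∃ g ∈ T, h = f * g}, ?_, ?_⟩
      · rintro _ ⟨f, hf, g, hg, rfl⟩
        exact mul_mem (hS hf) (hT hg)
      · ext w
        simp only [Set.mem_union, Set.mem_ofPred_eq]
        constructor
        · rintro (h | h) _ ⟨f, hf, g, hg, rfl⟩
          · simp [h f hf]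
          · simp [h g hg]
        · intro h
          by_contra! hc
          obtain ⟨⟨f, hf, hfw⟩, ⟨g, hg, hgw⟩⟩ := hc
          exact mul_ne_zero hfw hgw (h _ ⟨f, hf, g, hg, rfl⟩))

/-- `Z` is locally closed in the Zariski topology, i.e. it is a quasi-affine algebraic set. -/
def IsZariskiLocallyClosed (Z : Set W) : Prop :=
  @IsLocallyClosed W (zariskiTopology K W) Z

/-- `Z` is (non-empty and) irreducible in the Zariski topology. -/
def IsZariskiIrreducible (Z : Set W) : Prop :=
  @IsIrreducible W (zariskiTopology K W) Z

/-- The dimension of `Z`: the Krull dimension of `Z` with its Zariski subspace topology. -/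
noncomputable def zariskiDim (Z : Set W) : WithBot ℕ∞ :=
  @topologicalKrullDim Z ((zariskiTopology K W).induced Subtype.val)

/-- The algebra of restrictions to `Z` of polynomial functions on `W`. It is the coordinate ring
`K[W] / I(Z)` of the Zariski closure of `Z`. -/
def restrictedFunctions (Z : Set W) : Subalgebra K (Z → K) :=
  (vectorSpacePolynomials K W).map (AlgHom.pi fun z : Z => Pi.evalAlgHom K (fun _ : W => K) z.1)

/-- The prime (in fact maximal) ideal of functions that vanish at the point `z`. -/
def pointIdeal {Z : Set W} (z : Z) : Ideal (restrictedFunctions K Z) :=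
  RingHom.ker ((Pi.evalAlgHom K (fun _ : Z => K) z).comp (restrictedFunctions K Z).val)

instance {Z : Set W} (z : Z) : (pointIdeal K z).IsPrime :=
  RingHom.ker_isPrime _

/-- A locally closed `Z` (with its reduced structure) is smooth over `K` if it is smooth at each of
its points. As `Z` is open in its closure, its local ring at `z` is the localization of
`restrictedFunctions K Z` at `pointIdeal K z`, and `Algebra.IsSmoothAt` says that this local ring
is formally smooth over `K`. -/
def IsZariskiSmooth (Z : Set W) : Prop :=
  ∀ z : Z, Algebra.IsSmoothAt K (pointIdeal K z)

end Zariski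

/-! ### Differentials on a graded vector space `V = V⁰ ⊕ ⋯ ⊕ Vⁿ` -/

section Complexes

variable (K : Type*) [Field K] (n : ℕ) (V : ℕ → Type*) [∀ i, AddCommGroup (V i)]
  [∀ i, Module K (V i)]

/-- The vector space of degree preserving linear maps `V → V[1]`, where `V` is concentrated in
degrees `0, …, n`: families of linear maps `dⁱ : Vⁱ → Vⁱ⁺¹`, `0 ≤ i ≤ n`. -/
abbrev HomShift : Type _ :=
  ∀ i : Fin (n + 1), V i →ₗ[K] V (i + 1)

variable {n} in
/-- The set of all `d : V → V[1]` such that `d ∘ d = 0` and `rk (dⁱ) = rᵢ` for `0 ≤ i ≤ n`. -/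
def differentialsOfRank (r : Fin (n + 1) → ℕ) : Set (HomShift K n V) :=
  {d | (∀ (i : ℕ) (hi : i + 1 < n + 1), d ⟨i + 1, hi⟩ ∘ₗ d ⟨i, i.lt_succ_self.trans hi⟩ = 0) ∧
    ∀ i, Module.finrank K (LinearMap.range (d i)) = r i}

/-- The entry `rᵢ₋₁` of the vector `r = (r₀, …, rₙ)`, where `r₋₁ = 0`. -/
def prevEntry {n : ℕ} (r : Fin (n + 1) → ℕ) (i : Fin (n + 1)) : ℕ :=
  Fin.cases 0 (fun j => r j.castSucc) i

end Complexes

/-! ### Polynomial functions on a vector space -/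

section PolynomialFunctions

variable {K : Type*} [Field K] {W P : Type*} [AddCommGroup W] [Module K W]
  [AddCommGroup P] [Module K P]

/-! Choose a basis of each Vⁱ in three blocks of sizes rᵢ₋₁, hᵢ, rᵢ, where hᵢ is the dimension of
the homology. The matrix of dⁱ then has an rᵢ × rᵢ pivot A: first block of rows, last block of
columns. Where all pivots are invertible, the rank condition gives dⁱ = C A⁻¹ R, with C the columns
and R the rows through A (`Matrix.eq_mul_inv_mul_of_rank_eq`). Write R = (x | s | A). The equation
dⁱdⁱ⁻¹ = 0 says that R annihilates the pivot columns of dⁱ⁻¹, which determines x through the inverse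
of the previous pivot. So C and s are free coordinates, and this part of the variety is a principal
open subset of an affine space of dimension ∑ (vᵢ₊₁ + hᵢ) rᵢ (`differentialChart`).

Any two differentials d, e of the same rank vector lie in one such chart. In each degree the cycles
of d and e have a common complement, which extends to a common complement of their boundaries; a
basis adapted to these makes the pivots of both invertible (`exists_adapted_basis`,
`denom_differentialChart_ne_zero`).

The rest is formal (`smooth_irreducible_of_common_charts`): local closedness, smoothness and
dimension can be checked chart by chart, and irreducibility follows because two nonempty open sets
both meet a single irreducible chart. -/

theorem dual_mem_vectorSpacePolynomials (φ : Module.Dual K W) :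
    (fun w => φ w) ∈ vectorSpacePolynomials K W :=
  Algebra.subset_adjoin ⟨φ, rfl⟩

/-- A subalgebra of functions on `X` that contains all `φ ∘ F` with `φ` a linear functional contains
all `f ∘ F` with `f` polynomial. -/
theorem comp_mem_of_dual_comp_mem {X : Type*} {F : X → W} (S : Subalgebra K (X → K))
    (hS : ∀ φ : Module.Dual K W, (fun x => φ (F x)) ∈ S) {f : W → K}
    (hf : f ∈ vectorSpacePolynomials K W) : (fun x => f (F x)) ∈ S := by
  induction hf using Algebra.adjoin_induction with
  | mem f hf => obtain ⟨φ, rfl⟩ := hf; exact hS φ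
  | algebraMap c => exact S.algebraMap_mem c
  | add f g _ _ hf hg => exact S.add_mem hf hg
  | mul f g _ _ hf hg => exact S.mul_mem hf hg

theorem comp_linearMap_mem_vectorSpacePolynomials (L : P →ₗ[K] W) {f : W → K}
    (hf : f ∈ vectorSpacePolynomials K W) : (fun p => f (L p)) ∈ vectorSpacePolynomials K P :=
  comp_mem_of_dual_comp_mem _ (fun φ => dual_mem_vectorSpacePolynomials (φ ∘ₗ L)) hf

theorem comp_affine_mem_vectorSpacePolynomials (w₀ : W) (L : P →ₗ[K] W) {f : W → K}
    (hf : f ∈ vectorSpacePolynomials K W) :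
    (fun p => f (w₀ + L p)) ∈ vectorSpacePolynomials K P := by
  refine comp_mem_of_dual_comp_mem (F := fun p => w₀ + L p) _ (fun φ => ?_) hf
  have := add_mem ((vectorSpacePolynomials K P).algebraMap_mem (φ w₀))
    (dual_mem_vectorSpacePolynomials (φ ∘ₗ L))
  convert this using 1
  ext p
  simp

/-- The polynomial functions on a vector space over an infinite field form a polynomial ring. -/
noncomputable def mvPolynomialEquivVectorSpacePolynomials [Infinite K] {ι : Type*} [Finite ι]
    (b : Module.Basis ι K P) : MvPolynomial ι K ≃ₐ[K] vectorSpacePolynomials K P :=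
  AlgEquiv.ofBijective
    (MvPolynomial.aeval fun i => ⟨fun p => b.repr p i, dual_mem_vectorSpacePolynomials (b.coord i)⟩) <| by
    have key : ∀ q : MvPolynomial ι K, ∀ p : P,
        (MvPolynomial.aeval (fun i => (⟨fun p => b.repr p i, dual_mem_vectorSpacePolynomials (b.coord i)⟩ :
          vectorSpacePolynomials K P)) q).1 p = MvPolynomial.eval (b.repr p) q := by
      intro q p
      induction q using MvPolynomial.induction_on with
      | C a => simp
      | add q r hq hr => simp [hq, hr]
      | mul_X q i hq => simp [hq]
    constructor
    · intro q q' h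
      refine MvPolynomial.funext fun x => ?_
      have := b.repr.apply_symm_apply (Finsupp.equivFunOnFinite.symm x)
      have h2 := congrArg (fun f : vectorSpacePolynomials K P =>
        f.1 (b.repr.symm (Finsupp.equivFunOnFinite.symm x))) h
      simp only [key, this] at h2
      exact h2
    · rintro ⟨f, hf⟩
      suffices f ∈ (MvPolynomial.aeval (R := K) (fun i => (⟨fun p => b.repr p i,
          dual_mem_vectorSpacePolynomials (b.coord i)⟩ : vectorSpacePolynomials K P))).range.map
          (vectorSpacePolynomials K P).val by
        obtain ⟨g, ⟨q, rfl⟩, hq⟩ := this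
        exact ⟨q, Subtype.ext hq⟩
      refine comp_mem_of_dual_comp_mem (F := id) _ (fun φ => ?_) hf
      have := Fintype.ofFinite ι
      refine ⟨_, ⟨∑ i, MvPolynomial.C (φ (b i)) * MvPolynomial.X i, rfl⟩, ?_⟩
      ext p
      refine (key _ p).trans ?_
      conv_rhs => rw [id, ← b.sum_repr p, map_sum]
      simp [mul_comm]

variable (K P) in
instance isDomain_vectorSpacePolynomials [Infinite K] [FiniteDimensional K P] :
    IsDomain (vectorSpacePolynomials K P) :=
  (mvPolynomialEquivVectorSpacePolynomials (Module.finBasis K P)).symm.toMulEquiv.isDomain _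

variable (K P) in
instance formallySmooth_vectorSpacePolynomials [Infinite K] [FiniteDimensional K P] :
    Algebra.FormallySmooth K (vectorSpacePolynomials K P) :=
  .of_equiv (mvPolynomialEquivVectorSpacePolynomials (Module.finBasis K P))

variable (K P) in
theorem ringKrullDim_vectorSpacePolynomials [Infinite K] [FiniteDimensional K P] :
    ringKrullDim (vectorSpacePolynomials K P) = Module.finrank K P := by
  rw [← ringKrullDim_eq_of_ringEquiv
    (mvPolynomialEquivVectorSpacePolynomials (Module.finBasis K P)).toRingEquiv,
    MvPolynomial.ringKrullDim_of_isNoetherianRing]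
  simp

/-- The polynomial functions form a domain, so fg ≠ 0. This is the source of irreducibility and of
points in general position below. -/
theorem exists_mul_ne_zero_of_mem_vectorSpacePolynomials [Infinite K] [FiniteDimensional K P]
    {f g : P → K} (hf : f ∈ vectorSpacePolynomials K P) (hg : g ∈ vectorSpacePolynomials K P)
    (hf0 : f ≠ 0) (hg0 : g ≠ 0) : ∃ p, f p ≠ 0 ∧ g p ≠ 0 := by
  by_contra! h
  have : (⟨f, hf⟩ : vectorSpacePolynomials K P) * ⟨g, hg⟩ = 0 := by
    ext p
    by_cases hp : f p = 0
    · simp [hp]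
    · simp [h p hp]
  rcases mul_eq_zero.mp this with h | h
  · exact hf0 (congrArg Subtype.val h)
  · exact hg0 (congrArg Subtype.val h)

end PolynomialFunctions

/-! ### The Zariski topology: continuity and irreducibility of affine space -/

section ZariskiTopology

open Topology

variable {K : Type*} [Field K] {W P : Type*} [AddCommGroup W] [Module K W]
  [AddCommGroup P] [Module K P]

theorem isClosed_zariskiTopology_iff {Z : Set W} :
    IsClosed[zariskiTopology K W] Z ↔ IsZariskiClosed K Z := by
  rw [← @isOpen_compl_iff _ _ (zariskiTopology K W)]
  change Zᶜᶜ ∈ {Z | IsZariskiClosed K Z} ↔ _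
  rw [compl_compl]
  rfl

theorem isClosed_zeros {f : W → K} (hf : f ∈ vectorSpacePolynomials K W) :
    IsClosed[zariskiTopology K W] {w | f w = 0} :=
  isClosed_zariskiTopology_iff.mpr ⟨{f}, by simpa using hf, by simp⟩

theorem isOpen_nonzeros {f : W → K} (hf : f ∈ vectorSpacePolynomials K W) :
    IsOpen[zariskiTopology K W] {w | f w ≠ 0} :=
  (@isOpen_compl_iff _ _ (zariskiTopology K W)).mpr (isClosed_zeros hf)

theorem continuous_zariskiTopology_iff {X : Type*} [TopologicalSpace X] {F : X → W} :
    Continuous[_, zariskiTopology K W] F ↔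
      ∀ f ∈ vectorSpacePolynomials K W, IsClosed {x | f (F x) = 0} := by
  let := zariskiTopology K W
  constructor
  · intro hF f hf
    exact (isClosed_zeros hf).preimage hF
  · intro h
    rw [continuous_iff_isClosed]
    intro Z hZ
    obtain ⟨S, hS, rfl⟩ := isClosed_zariskiTopology_iff.mp hZ
    have : F ⁻¹' {w | ∀ f ∈ S, f w = 0} = ⋂ f ∈ S, {x | f (F x) = 0} := by
      ext; simp
    rw [this]
    exact isClosed_biInter fun f hf => h f (hS hf)

theorem continuous_zariskiTopology_affine (w₀ : W) (L : P →ₗ[K] W) :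
    Continuous[zariskiTopology K P, zariskiTopology K W] fun p => w₀ + L p := by
  let := zariskiTopology K P
  exact continuous_zariskiTopology_iff.mpr fun f hf =>
    isClosed_zeros (comp_affine_mem_vectorSpacePolynomials w₀ L hf)

theorem continuous_zariskiTopology_linearMap (L : P →ₗ[K] W) :
    Continuous[zariskiTopology K P, zariskiTopology K W] L := by
  simpa using continuous_zariskiTopology_affine 0 L

variable (K P) in
theorem irreducibleSpace_zariskiTopology [Infinite K] [FiniteDimensional K P] :
    @IrreducibleSpace P (zariskiTopology K P) := by
  let := zariskiTopology K P
  -- Every nonempty open set contains a nonempty principal open set; two of these meet because there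
  -- are no zero divisors.
  have aux : ∀ U : Set P, IsOpen U → U.Nonempty →
      ∃ f ∈ vectorSpacePolynomials K P, f ≠ 0 ∧ ∀ p, f p ≠ 0 → p ∈ U := by
    intro U hU ⟨p, hp⟩
    obtain ⟨S, hS, hSU⟩ := isClosed_zariskiTopology_iff.mp hU.isClosed_compl
    have : p ∉ {w | ∀ f ∈ S, f w = 0} := by rw [← hSU]; simpa using hp
    simp only [Set.mem_ofPred_eq, not_forall] at this
    obtain ⟨f, hf, hfp⟩ := this
    refine ⟨f, hS hf, fun h => hfp (by simp [h]), fun q hq => ?_⟩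
    by_contra hqU
    have : q ∈ Uᶜ := hqU
    rw [hSU] at this
    exact hq (this f hf)
  have : PreirreducibleSpace P := by
    refine PreirreducibleSpace.of_forall_nonempty_inter ?_
    intro U V hU hV hUne hVne
    obtain ⟨f, hf, hf0, hfU⟩ := aux U hU hUne
    obtain ⟨g, hg, hg0, hgV⟩ := aux V hV hVne
    obtain ⟨p, hfp, hgp⟩ := exists_mul_ne_zero_of_mem_vectorSpacePolynomials hf hg hf0 hg0
    exact ⟨p, hfU p hfp, hgV p hgp⟩
  exact { toNonempty := ⟨0⟩ }

end ZariskiTopology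

/-! ### Dimension of principal open subsets of affine space -/

section AffineDimension

open Topology TopologicalSpace

variable {K : Type*} [Field K] [Infinite K] {P : Type*} [AddCommGroup P] [Module K P]
  [FiniteDimensional K P]

/-- Send an irreducible closed subset of `X` to the prime ideal of the polynomials vanishing on it. -/
theorem zariskiDim_le_finrank (X : Set P) : zariskiDim K X ≤ Module.finrank K P := by
  let := zariskiTopology K P
  rw [← ringKrullDim_vectorSpacePolynomials K P, ringKrullDim, ← Order.krullDim_orderDual]
  let I : IrreducibleCloseds X → (PrimeSpectrum (vectorSpacePolynomials K P))ᵒᵈ := fun T =>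
    OrderDual.toDual
    { asIdeal :=
        { carrier := {f | ∀ x ∈ T, f.1 x.1 = 0}
          add_mem' := fun hf hg x hx => by simp [hf x hx, hg x hx]
          zero_mem' := fun x _ => rfl
          smul_mem' := fun f g hg x hx => by simp [hg x hx] }
      isPrime :=
        { ne_top' := fun h => by
            obtain ⟨x, hx⟩ := T.isIrreducible.nonempty
            have h1 := (Ideal.eq_top_iff_one _).mp h
            exact one_ne_zero (α := K) (h1 x hx)
          mem_or_mem' := fun {f g} hfg => by
            have cl : ∀ f : vectorSpacePolynomials K P, IsClosed {x : X | f.1 x.1 = 0} :=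
              fun f => (isClosed_zeros f.2).preimage continuous_subtype_val
            have := isPreirreducible_iff_isClosed_union_isClosed.mp T.isIrreducible.isPreirreducible
              _ _ (cl f) (cl g) fun x hx => mul_eq_zero.mp (hfg x hx)
            exact this } }
  -- A closed subset of X is recovered from the polynomials vanishing on it, so `I` is injective.
  have mem_of : ∀ T : IrreducibleCloseds X, ∀ x : X,
      (∀ f : vectorSpacePolynomials K P, (∀ y ∈ T, f.1 y.1 = 0) → f.1 x.1 = 0) → x ∈ T := by
    intro T x hx
    obtain ⟨Z, hZ, hZT⟩ := isClosed_induced_iff.mp T.isClosed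
    obtain ⟨S, hS, rfl⟩ := isClosed_zariskiTopology_iff.mp hZ
    have hmem : ∀ y : X, y ∈ T ↔ ∀ f ∈ S, f y.1 = 0 := fun y => by
      rw [← SetLike.mem_coe, ← hZT]; rfl
    exact (hmem x).mpr fun f hf => hx ⟨f, hS hf⟩ fun y hy => (hmem y).mp hy f hf
  refine Order.krullDim_le_of_strictMono I (Monotone.strictMono_of_injective ?_ ?_)
  · intro T T' h f hf x hx
    exact hf x (h hx)
  · intro T T' h
    have h' : ∀ f : vectorSpacePolynomials K P, (∀ y ∈ T, f.1 y.1 = 0) ↔ ∀ y ∈ T', f.1 y.1 = 0 :=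
      fun f => SetLike.ext_iff.mp (congrArg (fun p : (PrimeSpectrum (vectorSpacePolynomials K P))ᵒᵈ =>
        (OrderDual.ofDual p).asIdeal) h) f
    ext x
    exact ⟨fun hx => mem_of T' x fun f hf => (h' f).mpr hf x hx,
      fun hx => mem_of T x fun f hf => (h' f).mp hf x hx⟩

/-- A full flag of affine subspaces through p₀ traces a chain of irreducible closed subsets on the
open set δ ≠ 0. -/
theorem finrank_le_zariskiDim_nonzeros {δ : P → K} (hδ : δ ∈ vectorSpacePolynomials K P)
    {p₀ : P} (hp₀ : δ p₀ ≠ 0) : (Module.finrank K P : WithBot ℕ∞) ≤ zariskiDim K {p | δ p ≠ 0} := by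
  let := zariskiTopology K P
  let b := Module.finBasis K P
  let X : Set P := {p | δ p ≠ 0}
  have hX : IsOpenEmbedding (Subtype.val : X → P) := (isOpen_nonzeros hδ).isOpenEmbedding_subtypeVal
  -- The span of the first j basis vectors.
  let L : Fin (Module.finrank K P + 1) → Submodule K P := fun j =>
    ⨅ i : Fin (Module.finrank K P), ⨅ _ : (j : ℕ) ≤ i, LinearMap.ker (b.coord i)
  have mem_L : ∀ j p, p ∈ L j ↔ ∀ i : Fin (Module.finrank K P), (j : ℕ) ≤ i → b.coord i p = 0 := by
    intro j p
    simp [L, Submodule.mem_iInf]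
  have irr : ∀ j, IsIrreducible {p : P | p - p₀ ∈ L j} := by
    intro j
    let := zariskiTopology K (L j)
    have := irreducibleSpace_zariskiTopology K (L j)
    have h := (IrreducibleSpace.isIrreducible_univ (L j)).image (fun u => p₀ + (L j).subtype u)
      (continuous_zariskiTopology_affine p₀ (L j).subtype).continuousOn
    convert h using 1
    ext p
    simp only [Set.mem_ofPred_eq, Submodule.subtype_apply, Set.image_univ, Set.mem_range]
    constructor
    · intro hp
      exact ⟨⟨_, hp⟩, by simp⟩
    · rintro ⟨u, rfl⟩
      simp
  have closed : ∀ j, IsClosed {p : P | p - p₀ ∈ L j} := by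
    intro j
    have : {p : P | p - p₀ ∈ L j} = ⋂ i : Fin (Module.finrank K P), ⋂ _ : (j : ℕ) ≤ i,
        {p | b.coord i (-p₀ + LinearMap.id (R := K) p) = 0} := by
      ext p
      simp only [Set.mem_ofPred_eq, mem_L, Set.mem_iInter, LinearMap.id_apply, neg_add_eq_sub]
    rw [this]
    exact isClosed_iInter fun i => isClosed_iInter fun _ =>
      isClosed_zeros (comp_affine_mem_vectorSpacePolynomials _ _ (dual_mem_vectorSpacePolynomials _))
  let T : Fin (Module.finrank K P + 1) → IrreducibleCloseds X := fun j =>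
    { carrier := Subtype.val ⁻¹' {p : P | p - p₀ ∈ L j}
      isIrreducible' := ⟨⟨⟨p₀, hp₀⟩, by simp⟩, (irr j).isPreirreducible.preimage hX⟩
      isClosed' := (closed j).preimage continuous_subtype_val }
  have mem_T : ∀ j x, x ∈ T j ↔ x.1 - p₀ ∈ L j := fun _ _ => Iff.rfl
  have hT : StrictMono T := by
    refine Fin.strictMono_iff_lt_succ.mpr fun j => ?_
    refine SetLike.lt_iff_le_and_exists.mpr ⟨fun x hx => ?_, ?_⟩
    · rw [mem_T, mem_L] at hx ⊢
      intro i hi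
      exact hx i (by simp at hi ⊢; omega)
    -- Strictness: on the line p₀ + t bⱼ the polynomials δ and t are both nonzero, so some t ≠ 0
    -- stays inside δ ≠ 0 and leaves the smaller subspace.
    · have h1 := comp_affine_mem_vectorSpacePolynomials p₀ (LinearMap.toSpanSingleton K P (b j)) hδ
      obtain ⟨t, ht, ht0⟩ := exists_mul_ne_zero_of_mem_vectorSpacePolynomials h1
        (dual_mem_vectorSpacePolynomials (LinearMap.id : K →ₗ[K] K))
        (fun h => hp₀ (by simpa using congrFun h 0)) (fun h => one_ne_zero (congrFun h (1 : K)))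
      refine ⟨⟨_, ht⟩, ?_, ?_⟩
      · rw [mem_T, mem_L]
        intro i hi
        have : j ≠ i := by rintro rfl; simp at hi
        simp [this]
      · rw [mem_T, mem_L]
        intro h
        exact ht0 (by simpa using h j (by simp))
  exact Order.LTSeries.length_le_krullDim (LTSeries.mk _ T hT)

end AffineDimension

/-! ### Regular functions on a principal open set -/

section RegularFunctions

variable {K : Type*} [Field K] {P : Type*} [AddCommGroup P] [Module K P]

/-- The functions that are regular on the principal open set `δ ≠ 0` (with arbitrary values
elsewhere). -/
def regularFunctions (δ : vectorSpacePolynomials K P) : Subalgebra K (P → K) where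
  carrier := {F | ∃ (n : ℕ) (g : vectorSpacePolynomials K P),
    ∀ p, δ.1 p ≠ 0 → δ.1 p ^ n * F p = g.1 p}
  mul_mem' := by
    rintro F F' ⟨n, g, h⟩ ⟨n', g', h'⟩
    refine ⟨n + n', g * g', fun p hp => ?_⟩
    simp only [Pi.mul_apply, Subalgebra.coe_mul, ← h p hp, ← h' p hp]
    ring
  add_mem' := by
    rintro F F' ⟨n, g, h⟩ ⟨n', g', h'⟩
    refine ⟨n + n', δ ^ n' * g + δ ^ n * g', fun p hp => ?_⟩
    simp only [Pi.mul_apply, Pi.add_apply, Pi.pow_apply, Subalgebra.coe_mul, Subalgebra.coe_add,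
      Subalgebra.coe_pow, ← h p hp, ← h' p hp]
    ring
  algebraMap_mem' c := ⟨0, algebraMap _ _ c, fun p _ => by simp⟩

theorem le_regularFunctions (δ : vectorSpacePolynomials K P) :
    vectorSpacePolynomials K P ≤ regularFunctions δ :=
  fun f hf => ⟨0, ⟨f, hf⟩, by simp⟩

theorem inv_mem_regularFunctions {δ f g : vectorSpacePolynomials K P} (h : δ = f * g) :
    (f : P → K)⁻¹ ∈ regularFunctions δ := by
  refine ⟨1, g, fun p hp => ?_⟩
  subst h
  have : f.1 p ≠ 0 := fun h0 => hp (by simp [h0])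
  simp only [Subalgebra.coe_mul, pow_one, Pi.mul_apply, Pi.inv_apply]
  field_simp

end RegularFunctions

/-- A chart of `Z ⊆ W`: a linear map `coord : W → P` that identifies the points of `Z` where `denom`
does not vanish with a principal open subset of `P`, with regular inverse `param`. -/
structure ZariskiChart (K : Type*) [Field K] {W : Type*} [AddCommGroup W] [Module K W] (Z : Set W)
    (P : Type*) [AddCommGroup P] [Module K P] where
  /-- The coordinates. -/
  coord : W →ₗ[K] P
  /-- The equation of the complement of the chart. -/
  denom : vectorSpacePolynomials K P
  /-- The inverse of the coordinates. -/
  param : P → W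
  dual_param_mem : ∀ φ : Module.Dual K W, (fun p => φ (param p)) ∈ regularFunctions denom
  param_mem : ∀ p, denom.1 p ≠ 0 → param p ∈ Z
  coord_param : ∀ p, denom.1 p ≠ 0 → coord (param p) = p
  param_coord : ∀ z ∈ Z, denom.1 (coord z) ≠ 0 → param (coord z) = z

/-! ### Local geometry inside a chart -/

namespace ZariskiChart

open Topology TopologicalSpace

variable {K : Type*} [Field K] {W : Type*} [AddCommGroup W] [Module K W] {Z : Set W}
  {P : Type*} [AddCommGroup P] [Module K P] (c : ZariskiChart K Z P)

theorem comp_param_mem {f : W → K} (hf : f ∈ vectorSpacePolynomials K W) :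
    (fun p => f (c.param p)) ∈ regularFunctions c.denom :=
  comp_mem_of_dual_comp_mem _ c.dual_param_mem hf

theorem denom_coord_mem : (fun w => c.denom.1 (c.coord w)) ∈ vectorSpacePolynomials K W :=
  comp_linearMap_mem_vectorSpacePolynomials _ c.denom.2

/-- The inverse of a chart as a map from the principal open subset of `P` to `Z`. -/
def paramOn (p : {p | c.denom.1 p ≠ 0}) : Z :=
  ⟨c.param p, c.param_mem p p.2⟩

theorem range_paramOn : Set.range c.paramOn = {z : Z | c.denom.1 (c.coord z) ≠ 0} := by
  ext z
  constructor
  · rintro ⟨p, rfl⟩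
    change c.denom.1 (c.coord (c.param p)) ≠ 0
    rw [c.coord_param p p.2]
    exact p.2
  · intro hz
    exact ⟨⟨_, hz⟩, Subtype.ext (c.param_coord z z.2 hz)⟩

/-- `coord` is a continuous left inverse, and the image is cut out by the nonvanishing of a
polynomial. -/
theorem isOpenEmbedding_paramOn :
    let _ := zariskiTopology K W
    let _ := zariskiTopology K P
    IsOpenEmbedding c.paramOn := by
  intro _ _
  have hcont : Continuous c.paramOn := by
    refine Continuous.subtype_mk (continuous_zariskiTopology_iff.mpr fun f hf => ?_) _
    obtain ⟨n, g, hg⟩ := c.comp_param_mem hf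
    convert (isClosed_zeros g.2).preimage continuous_subtype_val using 1
    ext p
    have hp : c.denom.1 p.1 ≠ 0 := p.2
    change f (c.param p) = 0 ↔ g.1 p.1 = 0
    simp [← hg p.1 hp, hp]
  have hcomp : (fun z : Z => c.coord z) ∘ c.paramOn = Subtype.val :=
    funext fun p => c.coord_param p p.2
  have hcoord : Continuous fun z : Z => c.coord z :=
    (continuous_zariskiTopology_linearMap c.coord).comp continuous_subtype_val
  refine ⟨⟨.of_comp hcont hcoord (hcomp ▸ IsInducing.subtypeVal), ?_⟩, ?_⟩
  · refine Function.Injective.of_comp (f := fun z : Z => c.coord z) ?_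
    rw [hcomp]
    exact Subtype.val_injective
  · rw [c.range_paramOn]
    exact (isOpen_nonzeros c.denom_coord_mem).preimage continuous_subtype_val

/-- The identity `param (coord w) = w` becomes polynomial after clearing denominators, so it passes
from Z to its closure wherever the denominator is nonzero. -/
theorem nonzeros_inter_closure_subset :
    let _ := zariskiTopology K W
    {w | c.denom.1 (c.coord w) ≠ 0} ∩ closure Z ⊆ Z := by
  intro _ w ⟨hw, hwZ⟩
  rw [Set.mem_ofPred_eq] at hw
  suffices c.param (c.coord w) = w by rw [← this]; exact c.param_mem _ hw
  rw [← sub_eq_zero, ← Module.forall_dual_apply_eq_zero_iff K]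
  intro φ
  obtain ⟨n, g, hg⟩ := c.dual_param_mem φ
  -- The extra factor `denom` makes h vanish also at the points of Z outside the chart.
  let h : W → K := (fun w => c.denom.1 (c.coord w)) *
    ((fun w => c.denom.1 (c.coord w)) ^ n * (fun w => φ w) - fun w => g.1 (c.coord w))
  have hh : h ∈ vectorSpacePolynomials K W :=
    mul_mem c.denom_coord_mem (sub_mem (mul_mem (pow_mem c.denom_coord_mem n)
      (dual_mem_vectorSpacePolynomials φ)) (comp_linearMap_mem_vectorSpacePolynomials _ g.2))
  have hZ : closure Z ⊆ {w | h w = 0} := by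
    refine closure_minimal (fun z hz => ?_) (isClosed_zeros hh)
    by_cases h0 : c.denom.1 (c.coord z) = 0
    · simp [h, h0]
    · have := hg _ h0
      simp only [c.param_coord z hz h0] at this
      simp [h, this]
  have := hZ hwZ
  simp only [h, Set.mem_ofPred_eq, Pi.mul_apply, Pi.sub_apply, Pi.pow_apply, ← hg _ hw, mul_eq_zero,
    hw, false_or, ← mul_sub, pow_eq_zero_iff', false_and] at this
  rw [map_sub, ← neg_sub, this, neg_zero]

/-- The restriction to `Z` of the pull-back of polynomial functions along `coord`. -/
noncomputable def pullback : vectorSpacePolynomials K P →ₐ[K] restrictedFunctions K Z where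
  toFun f := ⟨fun z => f.1 (c.coord z),
    ⟨_, comp_linearMap_mem_vectorSpacePolynomials c.coord f.2, rfl⟩⟩
  map_one' := rfl
  map_mul' _ _ := rfl
  map_zero' := rfl
  map_add' _ _ := rfl
  commutes' _ := rfl

theorem pullback_apply (f : vectorSpacePolynomials K P) (z : Z) :
    (c.pullback f).1 z = f.1 (c.coord z) := rfl

theorem exists_pullback_eq (a : restrictedFunctions K Z) :
    ∃ (n : ℕ) (g : vectorSpacePolynomials K P), c.pullback (c.denom ^ n) * a = c.pullback g := by
  obtain ⟨_, f, hf, rfl⟩ := a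
  obtain ⟨n, g, hg⟩ := c.comp_param_mem hf
  -- One more factor `denom` than needed in the chart, so that the equation also holds, as 0 = 0,
  -- outside it.
  refine ⟨n + 1, c.denom * g, Subtype.ext (funext fun z => ?_)⟩
  by_cases h0 : c.denom.1 (c.coord z) = 0
  · simp [pullback_apply, h0]
  · have := hg _ h0
    simp only [c.param_coord z z.2 h0] at this
    simp only [Subalgebra.coe_mul, Pi.mul_apply, pullback_apply, ← this, Subalgebra.coe_pow,
      Pi.pow_apply]
    change _ * f z = _
    ring

theorem denom_mul_eq_of_pullback_eq {f g : vectorSpacePolynomials K P}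
    (h : c.pullback f = c.pullback g) : c.denom * f = c.denom * g := by
  ext p
  by_cases h0 : c.denom.1 p = 0
  · simp [h0]
  · have := congrFun (congrArg Subtype.val h) ⟨c.param p, c.param_mem p h0⟩
    simp only [pullback_apply, c.coord_param p h0] at this
    simp [this]

/-- The local ring of Z at z is also the localization of the polynomial ring of P at the contracted
prime: up to powers of `denom`, a unit at z, restricted functions are pullbacks, and `pullback` is
injective. Smoothness then follows from that of a polynomial ring and of a localization. -/
theorem formallySmooth_of_isLocalizationAtPrime [Infinite K] [FiniteDimensional K P] {z : Z}
    (hz : c.denom.1 (c.coord z) ≠ 0) (R : Type*) [CommRing R] [Algebra (restrictedFunctions K Z) R]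
    [Algebra K R] [IsScalarTower K (restrictedFunctions K Z) R]
    [IsLocalization.AtPrime R (pointIdeal K z)] : Algebra.FormallySmooth K R := by
  let ψ : vectorSpacePolynomials K P →+* R :=
    (algebraMap (restrictedFunctions K Z) R).comp c.pullback.toRingHom
  let := ψ.toAlgebra
  have hψ : ∀ f, algebraMap (vectorSpacePolynomials K P) R f =
    algebraMap (restrictedFunctions K Z) R (c.pullback f) := fun _ => rfl
  have : IsScalarTower K (vectorSpacePolynomials K P) R := .of_algebraMap_eq fun k => by
    rw [hψ, AlgHom.commutes, ← IsScalarTower.algebraMap_apply]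
  let q : Ideal (vectorSpacePolynomials K P) := (pointIdeal K z).comap c.pullback.toRingHom
  have hq : ∀ f, f ∈ q.primeCompl ↔ c.pullback f ∈ (pointIdeal K z).primeCompl := fun _ => Iff.rfl
  have hdenom : c.denom ∈ q.primeCompl := hz
  have : IsLocalization q.primeCompl R := by
    refine ⟨?_, ?_, ?_⟩
    · rintro ⟨f, hf⟩
      exact IsLocalization.map_units R (⟨_, hf⟩ : (pointIdeal K z).primeCompl)
    · intro x
      obtain ⟨⟨a, s⟩, has⟩ := IsLocalization.surj (pointIdeal K z).primeCompl x
      obtain ⟨n, f, hf⟩ := c.exists_pullback_eq a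
      obtain ⟨m, g, hg⟩ := c.exists_pullback_eq s.1
      have hgq : c.denom ^ n * g ∈ q.primeCompl := by
        refine mul_mem (pow_mem hdenom n) ?_
        rw [hq, ← hg]
        exact mul_mem ((hq _).mp (pow_mem hdenom m)) s.2
      -- The fraction a / s, with numerator and denominator both multiplied by `denom ^ (n + m)`.
      refine ⟨⟨c.denom ^ m * f, ⟨_, hgq⟩⟩, ?_⟩
      simp only [hψ, map_mul, ← hf, ← hg] at has ⊢
      linear_combination (algebraMap (restrictedFunctions K Z) R (c.pullback (c.denom ^ n)) *
        algebraMap (restrictedFunctions K Z) R (c.pullback (c.denom ^ m))) * has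
    · intro f g hfg
      rw [hψ, hψ] at hfg
      obtain ⟨s, hs⟩ := IsLocalization.exists_of_eq (M := (pointIdeal K z).primeCompl) hfg
      obtain ⟨n, h, hh⟩ := c.exists_pullback_eq s.1
      have hhq : h ∈ q.primeCompl := by
        rw [hq, ← hh]
        exact mul_mem ((hq _).mp (pow_mem hdenom n)) s.2
      refine ⟨⟨_, mul_mem hdenom hhq⟩, ?_⟩
      have : c.pullback (h * f) = c.pullback (h * g) := by
        rw [map_mul, map_mul, ← hh, mul_assoc, mul_assoc, hs]
      simpa only [mul_assoc] using c.denom_mul_eq_of_pullback_eq this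
  have : Algebra.FormallySmooth (vectorSpacePolynomials K P) R := .of_isLocalization q.primeCompl
  exact Algebra.FormallySmooth.comp K (vectorSpacePolynomials K P) R

theorem isSmoothAt [Infinite K] [FiniteDimensional K P] {z : Z}
    (hz : c.denom.1 (c.coord z) ≠ 0) : Algebra.IsSmoothAt K (pointIdeal K z) :=
  c.formallySmooth_of_isLocalizationAtPrime hz _

end ZariskiChart

/-! ### From common charts to a smooth irreducible variety -/

section Atlas

open Topology TopologicalSpace

variable {K : Type*} [Field K] [Infinite K] {W : Type*} [AddCommGroup W] [Module K W] {Z : Set W}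
  {P : Type*} [AddCommGroup P] [Module K P] [FiniteDimensional K P]

/-- A set in which any two points lie in a common chart is a smooth irreducible variety. -/
theorem smooth_irreducible_of_common_charts (hne : Z.Nonempty)
    (hZ : ∀ x ∈ Z, ∀ y ∈ Z, ∃ c : ZariskiChart K Z P,
      c.denom.1 (c.coord x) ≠ 0 ∧ c.denom.1 (c.coord y) ≠ 0) :
    IsZariskiLocallyClosed K Z ∧ IsZariskiSmooth K Z ∧ IsZariskiIrreducible K Z ∧
      zariskiDim K Z = Module.finrank K P := by
  let := zariskiTopology K W
  let := zariskiTopology K P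
  have irrP := irreducibleSpace_zariskiTopology K P
  refine ⟨?_, ?_, ?_, ?_⟩
  · refine ((isLocallyClosed_tfae Z).out 0 3).mpr fun z hz => ?_
    obtain ⟨c, hc, -⟩ := hZ z hz z hz
    exact ⟨_, hc, isOpen_nonzeros c.denom_coord_mem, c.nonzeros_inter_closure_subset⟩
  · intro z
    obtain ⟨c, hc, -⟩ := hZ z z.2 z z.2
    exact c.isSmoothAt hc
  · refine ⟨hne, fun U V hU hV ⟨x, hx, hxU⟩ ⟨y, hy, hyV⟩ => ?_⟩
    obtain ⟨c, hcx, hcy⟩ := hZ x hx y hy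
    have hD : IsOpen {p | c.denom.1 p ≠ 0} := isOpen_nonzeros c.denom.2
    have : PreirreducibleSpace {p | c.denom.1 p ≠ 0} := Subtype.preirreducibleSpace
      ((IrreducibleSpace.isIrreducible_univ P).isPreirreducible.open_subset hD (Set.subset_univ _))
    have hcont : Continuous fun p => (c.paramOn p).1 :=
      continuous_subtype_val.comp c.isOpenEmbedding_paramOn.continuous
    obtain ⟨p, hpU, hpV⟩ := nonempty_preirreducible_inter (hU.preimage hcont) (hV.preimage hcont)
      ⟨⟨_, hcx⟩, by simpa [ZariskiChart.paramOn, c.param_coord x hx hcx] using hxU⟩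
      ⟨⟨_, hcy⟩, by simpa [ZariskiChart.paramOn, c.param_coord y hy hcy] using hyV⟩
    exact ⟨_, (c.paramOn p).2, hpU, hpV⟩
  · refine le_antisymm ?_ ?_
    · have : Nonempty (IrreducibleCloseds Z) :=
        (hne.to_subtype).map fun z => ⟨closure {z}, isIrreducible_singleton.closure, isClosed_closure⟩
      -- The coheight of T involves only irreducible closed sets containing T. They all meet any
      -- chart that meets T, so the coheight can be computed in that chart.
      rw [zariskiDim, topologicalKrullDim, Order.krullDim_eq_iSup_coheight]
      refine iSup_le fun T => ?_
      obtain ⟨z, hz⟩ := T.isIrreducible.nonempty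
      obtain ⟨c, hc, -⟩ := hZ z z.2 z z.2
      let e := IrreducibleCloseds.orderIsoOfIsOpenEmbedding c.paramOn c.isOpenEmbedding_paramOn
      obtain ⟨T', hT'⟩ := e.surjective ⟨T, ⟨⟨_, hc⟩, by
        simpa [ZariskiChart.paramOn, c.param_coord z z.2 hc] using hz⟩⟩
      have hT : IrreducibleCloseds.map c.paramOn c.isOpenEmbedding_paramOn.continuous T' = T :=
        congrArg Subtype.val hT'
      rw [← hT, c.isOpenEmbedding_paramOn.coheight_map]
      exact (Order.coheight_le_krullDim T').trans (zariskiDim_le_finrank _)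
    · obtain ⟨z, hz⟩ := hne
      obtain ⟨c, hc, -⟩ := hZ z hz z hz
      exact (finrank_le_zariskiDim_nonzeros c.denom.2 hc).trans
        c.isOpenEmbedding_paramOn.isInducing.topologicalKrullDim_le

end Atlas

/-! ### Common complements and adapted bases -/

section CommonComplement

variable {K : Type*} [Field K] {V : Type*} [AddCommGroup V] [Module K V]

/-- A vector space is not the union of two proper subspaces: if it were, then for u ∉ A and w ∉ B
the sum u + w would lie in neither. -/
theorem exists_notMem_of_ne_top {A B : Submodule K V} (hA : A ≠ ⊤) (hB : B ≠ ⊤) :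
    ∃ v, v ∉ A ∧ v ∉ B := by
  by_contra! h
  obtain ⟨u, hu⟩ := SetLike.exists_not_mem_of_ne_top A hA rfl
  obtain ⟨w, hw⟩ := SetLike.exists_not_mem_of_ne_top B hB rfl
  have hwA : w ∈ A := by_contra fun h' => hw (h w h')
  have hwu : u + w ∉ A := fun h' => hu (by simpa using A.sub_mem h' hwA)
  exact hw (by simpa using B.sub_mem (h _ hwu) (h u hu))

theorem disjoint_sup_span_singleton {A C : Submodule K V} (h : Disjoint C A) {v : V}
    (hv : v ∉ A ⊔ C) : Disjoint (C ⊔ K ∙ v) A := by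
  rw [Submodule.disjoint_def]
  intro x hx hxA
  obtain ⟨c, hc, y, hy, rfl⟩ := Submodule.mem_sup.mp hx
  obtain ⟨t, rfl⟩ := Submodule.mem_span_singleton.mp hy
  have ht : t = 0 := by
    by_contra ht
    refine hv ?_
    have : t • v ∈ A ⊔ C := by
      have := (A ⊔ C).sub_mem (Submodule.mem_sup_left hxA : _ ∈ A ⊔ C) (Submodule.mem_sup_right hc)
      simpa using this
    simpa [smul_smul, inv_mul_cancel₀ ht] using (A ⊔ C).smul_mem t⁻¹ this
  subst ht
  simp only [zero_smul, add_zero] at hxA ⊢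
  exact Submodule.disjoint_def.mp h c hc hxA

variable [FiniteDimensional K V]

/-- Two subspaces of the same dimension have a common complement containing any given subspace that
meets both trivially. -/
theorem exists_common_complement {A B : Submodule K V}
    (hAB : Module.finrank K A = Module.finrank K B) (C : Submodule K V)
    (hCA : Disjoint C A) (hCB : Disjoint C B) :
    ∃ N, C ≤ N ∧ Disjoint N A ∧ Disjoint N B ∧
      Module.finrank K A + Module.finrank K N = Module.finrank K V := by
  induction hk : Module.finrank K V - Module.finrank K C using Nat.strong_induction_on
    generalizing C with
  | h k ih =>
    have key : ∀ D : Submodule K V, Disjoint C D →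
        Module.finrank K ↥(D ⊔ C) = Module.finrank K D + Module.finrank K C := by
      intro D hD
      have := Submodule.finrank_sup_add_finrank_inf_eq D C
      rwa [hD.symm.eq_bot, finrank_bot, add_zero] at this
    by_cases hC : Module.finrank K A + Module.finrank K C = Module.finrank K V
    · exact ⟨C, le_rfl, hCA, hCB, hC⟩
    · have hA : A ⊔ C ≠ ⊤ := fun h => hC (by rw [← key A hCA, h, finrank_top])
      have hB : B ⊔ C ≠ ⊤ := fun h => hC (by rw [hAB, ← key B hCB, h, finrank_top])
      -- A vector outside both sums enlarges C without meeting A or B; the induction is on the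
      -- codimension of C.
      obtain ⟨v, hvA, hvB⟩ := exists_notMem_of_ne_top hA hB
      have hlt : C < C ⊔ K ∙ v := by
        refine lt_of_le_of_ne le_sup_left fun h => hvA (Submodule.mem_sup_right ?_)
        rw [h]
        exact Submodule.mem_sup_right (Submodule.mem_span_singleton_self v)
      have h1 := Submodule.finrank_lt_finrank_of_lt hlt
      have h2 := Submodule.finrank_le (C ⊔ K ∙ v)
      obtain ⟨N, hN, h⟩ := ih _ (by omega) (C ⊔ K ∙ v) (disjoint_sup_span_singleton hCA hvA)
        (disjoint_sup_span_singleton hCB hvB) rfl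
      exact ⟨N, hlt.le.trans hN, h⟩

/-- A basis of `V` adapted to two flags `B ≤ Z` and `B' ≤ Z'` with the same dimensions. -/
theorem exists_adapted_basis {B B' Z Z' : Submodule K V} (hB : B ≤ Z) (hB' : B' ≤ Z') {a h c : ℕ}
    (ha : Module.finrank K B = a) (ha' : Module.finrank K B' = a)
    (hc : Module.finrank K Z + c = Module.finrank K V)
    (hc' : Module.finrank K Z' + c = Module.finrank K V)
    (hh : a + h + c = Module.finrank K V) :
    ∃ b : Module.Basis (Fin a ⊕ (Fin h ⊕ Fin c)) K V,
      ((∀ v ∈ B, (∀ q, b.repr v (Sum.inl q) = 0) → v = 0) ∧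
        ∀ x : Fin c → K, ∑ k, x k • b (Sum.inr (Sum.inr k)) ∈ Z → x = 0) ∧
      ((∀ v ∈ B', (∀ q, b.repr v (Sum.inl q) = 0) → v = 0) ∧
        ∀ x : Fin c → K, ∑ k, x k • b (Sum.inr (Sum.inr k)) ∈ Z' → x = 0) := by
  -- C is a common complement of the cycles and N ⊇ C one of the boundaries. The three blocks of the
  -- basis span B, a complement H of C in N, and C; although B' is not spanned by a block, N is
  -- still complementary to it.
  obtain ⟨C, -, hCZ, hCZ', hC⟩ := exists_common_complement (A := Z) (B := Z') (by omega) ⊥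
    disjoint_bot_left disjoint_bot_left
  obtain ⟨N, hCN, hNB, hNB', hN⟩ := exists_common_complement (A := B) (B := B') (by omega) C
    (hCZ.mono_right hB) (hCZ'.mono_right hB')
  have hcompl : IsCompl B N := by
    refine ⟨hNB.symm, codisjoint_iff.mpr (Submodule.eq_top_of_finrank_eq ?_)⟩
    have := Submodule.finrank_sup_add_finrank_inf_eq B N
    rw [hNB.symm.eq_bot, finrank_bot] at this
    omega
  obtain ⟨H, hH⟩ := (C.comap N.subtype).exists_isCompl
  have hCc : Module.finrank K (C.comap N.subtype) = c := by
    rw [(Submodule.comapSubtypeEquivOfLe hCN).finrank_eq]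
    omega
  have hHh : Module.finrank K H = h := by
    have := Submodule.finrank_add_eq_of_isCompl hH
    omega
  let bN : Module.Basis (Fin h ⊕ Fin c) K N :=
    ((Module.finBasisOfFinrankEq K H hHh).prod (Module.finBasisOfFinrankEq K _ hCc)).map
      (Submodule.prodEquivOfIsCompl _ _ hH.symm)
  let b : Module.Basis (Fin a ⊕ (Fin h ⊕ Fin c)) K V :=
    ((Module.finBasisOfFinrankEq K B ha).prod bN).map (Submodule.prodEquivOfIsCompl _ _ hcompl)
  have hbN : ∀ k, b (Sum.inr k) ∈ N := fun k => by simp [b]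
  have hbC : ∀ k, b (Sum.inr (Sum.inr k)) ∈ C := fun k => by
    have : (bN (Sum.inr k)) ∈ C.comap N.subtype := by simp [bN, -Submodule.mem_comap]
    simpa [b] using this
  have h1 : ∀ v, (∀ q, b.repr v (Sum.inl q) = 0) → v ∈ N := by
    intro v hv
    rw [← b.sum_repr v, Fintype.sum_sum_type]
    refine N.add_mem (by simp [hv]) (N.sum_mem fun k _ => N.smul_mem _ (hbN k))
  have h2 : ∀ x : Fin c → K, ∑ k, x k • b (Sum.inr (Sum.inr k)) = 0 → x = 0 := by
    intro x hx
    exact funext (Fintype.linearIndependent_iff.mp (b.linearIndependent.comp _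
      (Sum.inr_injective.comp Sum.inr_injective)) x hx)
  have h3 : ∀ x : Fin c → K, ∑ k, x k • b (Sum.inr (Sum.inr k)) ∈ C := fun x =>
    C.sum_mem fun k _ => C.smul_mem _ (hbC k)
  exact ⟨b, ⟨fun v hv hq => Submodule.disjoint_def.mp hNB v (h1 v hq) hv,
      fun x hx => h2 x (Submodule.disjoint_def.mp hCZ _ (h3 x) hx)⟩,
    fun v hv hq => Submodule.disjoint_def.mp hNB' v (h1 v hq) hv,
      fun x hx => h2 x (Submodule.disjoint_def.mp hCZ' _ (h3 x) hx)⟩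

end CommonComplement

/-! ### Matrices determined by an invertible block of full rank -/

namespace Matrix

variable {K : Type*} [Field K] {m k κ : Type*} [Fintype k] [Fintype κ]

theorem rank_submatrix_le_rank (M : Matrix m k K) (q : κ → m) (c : κ → k) :
    (M.submatrix q c).rank ≤ M.rank := by
  rw [← eRank_toNat_eq_rank, ← eRank_toNat_eq_rank]
  exact ENat.toNat_le_toNat (eRank_submatrix_le M q c)
    (ne_top_of_le_ne_top (by simp [ENat.card_eq_coe_fintype_card]) M.eRank_le_card_width)

variable [DecidableEq κ]

theorem card_le_rank_of_submatrix_det_ne_zero (M : Matrix m k K) (q : κ → m) (c : κ → k)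
    (hA : (M.submatrix q c).det ≠ 0) : Fintype.card κ ≤ M.rank := by
  rw [← rank_of_det_ne_zero hA]
  exact M.rank_submatrix_le_rank q c

/-- If `M` has an invertible square block of size `rk M`, then `M` is determined by the rows and the
columns of this block. -/
theorem eq_mul_inv_mul_of_rank_eq [Finite m] (M : Matrix m k K) (q : κ → m) (c : κ → k)
    (hA : (M.submatrix q c).det ≠ 0) (hM : M.rank = Fintype.card κ) :
    M = M.submatrix id c * ((M.submatrix q c)⁻¹ * M.submatrix q id) := by
  have hrank : (M.submatrix id c).rank = Fintype.card κ :=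
    (rank_le_card_width _).antisymm
      (card_le_rank_of_submatrix_det_ne_zero (M.submatrix id c) q id hA)
  have hle : LinearMap.range (M.submatrix id c).mulVecLin ≤ LinearMap.range M.mulVecLin := by
    rw [range_mulVecLin, range_mulVecLin]
    refine Submodule.span_mono ?_
    rintro _ ⟨j, rfl⟩
    exact ⟨c j, rfl⟩
  -- The selected columns already span the column space, so M = CX for some X; restricting to the
  -- rows q identifies X as A⁻¹R.
  have heq := Submodule.eq_of_le_of_finrank_le hle (by
    change M.rank ≤ (M.submatrix id c).rank
    rw [hM, hrank])
  have hcol : ∀ j, ∃ x, (M.submatrix id c) *ᵥ x = M.col j := by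
    intro j
    have : M.col j ∈ LinearMap.range M.mulVecLin := by
      rw [range_mulVecLin]
      exact Submodule.subset_span ⟨j, rfl⟩
    rw [← heq] at this
    exact this
  choose x hx using hcol
  have hMX : M = M.submatrix id c * (of x)ᵀ := by
    ext i j
    exact (congrFun (hx j) i).symm
  have hX : M.submatrix q id = M.submatrix q c * (of x)ᵀ := by
    conv_lhs => rw [hMX]
    rfl
  rw [hX, nonsing_inv_mul_cancel_left _ _ hA.isUnit]
  exact hMX

theorem rank_eq_card_of_eq_mul (M : Matrix m k K) (q : κ → m) (c : κ → k)
    (hA : (M.submatrix q c).det ≠ 0) {X : Matrix m κ K} {Y : Matrix κ k K} (hM : M = X * Y) :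
    M.rank = Fintype.card κ := by
  refine le_antisymm ?_ (M.card_le_rank_of_submatrix_det_ne_zero q c hA)
  rw [hM]
  exact (rank_mul_le_left X Y).trans (rank_le_card_width X)

end Matrix

/-! ### Matrices with entries in an algebra of functions -/

section MatrixValuedFunctions

variable {K X : Type*} [Field K] (S : Subalgebra K (X → K))

/-- The matrix-valued functions on `X` whose entries lie in `S`. -/
def EntriesMem {m k : Type*} (M : X → Matrix m k K) : Prop :=
  ∀ i j, (fun x => M x i j) ∈ S

namespace EntriesMem

variable {S} {m k l : Type*}

theorem neg {M : X → Matrix m k K} (hM : EntriesMem S M) : EntriesMem S fun x => -M x :=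
  fun i j => S.neg_mem (hM i j)

theorem zero : EntriesMem S fun _ => (0 : Matrix m k K) :=
  fun _ _ => S.zero_mem

theorem mul [Fintype k] {M : X → Matrix m k K} {N : X → Matrix k l K} (hM : EntriesMem S M)
    (hN : EntriesMem S N) : EntriesMem S fun x => M x * N x := by
  intro i j
  have : (fun x => (M x * N x) i j) = ∑ t, (fun x => M x i t) * fun x => N x t j := by
    ext x
    simp [Matrix.mul_apply]
  rw [this]
  exact S.sum_mem fun t _ => S.mul_mem (hM i t) (hN t j)

theorem submatrix {m' k' : Type*} {M : X → Matrix m k K} (hM : EntriesMem S M) (q : m' → m)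
    (c : k' → k) : EntriesMem S fun x => (M x).submatrix q c :=
  fun i j => hM (q i) (c j)

theorem fromCols {M : X → Matrix m k K} {N : X → Matrix m l K} (hM : EntriesMem S M)
    (hN : EntriesMem S N) : EntriesMem S fun x => Matrix.fromCols (M x) (N x) := by
  rintro i (j | j)
  · exact hM i j
  · exact hN i j

variable [Fintype m] [DecidableEq m]

theorem det {M : X → Matrix m m K} (hM : EntriesMem S M) : (fun x => (M x).det) ∈ S := by
  have : (fun x => (M x).det) =
      ∑ σ : Equiv.Perm m, (Equiv.Perm.sign σ : ℤ) • ∏ i, fun x => M x (σ i) i := by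
    ext x
    simp [Matrix.det_apply, Units.smul_def]
  rw [this]
  exact S.sum_mem fun σ _ => S.zsmul_mem (S.prod_mem fun i _ => hM _ _) _

theorem inv {M : X → Matrix m m K} (hM : EntriesMem S M) (h : (fun x => (M x).det)⁻¹ ∈ S) :
    EntriesMem S fun x => (M x)⁻¹ := by
  intro i j
  have : (fun x => (M x)⁻¹ i j) = (fun x => (M x).det)⁻¹ * fun x => (M x).adjugate i j := by
    ext x
    simp [Matrix.inv_def]
  rw [this]
  refine S.mul_mem h ?_
  simp only [Matrix.adjugate_apply]
  refine det fun a b => ?_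
  by_cases hab : a = j
  · simp only [hab, Matrix.updateRow_self]
    exact S.algebraMap_mem _
  · simp only [Matrix.updateRow_ne hab]
    exact hM a b

theorem linearMap_apply {k : Type*} [Fintype k] [DecidableEq k] {M : X → Matrix m k K}
    (hM : EntriesMem S M) (φ : Matrix m k K →ₗ[K] K) : (fun x => φ (M x)) ∈ S := by
  have : (fun x => φ (M x)) = ∑ i, ∑ j, φ (Matrix.single i j 1) • fun x => M x i j := by
    ext x
    conv_lhs => rw [Matrix.matrix_eq_sum_single (M x)]
    simp only [map_sum, Finset.sum_apply, Pi.smul_apply, smul_eq_mul]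
    refine Finset.sum_congr rfl fun i _ => Finset.sum_congr rfl fun j _ => ?_
    rw [mul_comm, ← smul_eq_mul, ← map_smul, Matrix.smul_single, smul_eq_mul, mul_one]
  rw [this]
  exact S.sum_mem fun i _ => S.sum_mem fun j _ => S.smul_mem (hM i j) _

end EntriesMem

end MatrixValuedFunctions

/-! ### Matrix coordinates for differentials -/

section ComplexChart

open Matrix

variable {K : Type*} [Field K] {n : ℕ} {ρ h : ℕ → ℕ}

/-- The index set of a basis of the degree `i` part, the three blocks corresponding to coordinates
modulo a complement of the boundaries, to the homology and to a complement of the cycles. -/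
abbrev BlockIndex (ρ h : ℕ → ℕ) (i : ℕ) : Type :=
  Fin (ρ i) ⊕ (Fin (h i) ⊕ Fin (ρ (i + 1)))

variable (K n ρ h) in
/-- The coordinate space of the charts of the variety of differentials. -/
abbrev ChartSpace : Type _ :=
  ∀ i : Fin (n + 1), Matrix (BlockIndex ρ h (i + 1)) (Fin (ρ (i + 1))) K ×
    Matrix (Fin (ρ (i + 1))) (Fin (h i)) K

namespace ChartSpace

variable (p : ChartSpace K n ρ h)

/-- The square block of `p` that is required to be invertible. -/
def pivot (i : Fin (n + 1)) : Matrix (Fin (ρ (i + 1))) (Fin (ρ (i + 1))) K :=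
  (p i).1.submatrix Sum.inl id

/-- The block determined by the condition that the square of the differential vanishes. -/
noncomputable def boundaryBlock : ∀ i : Fin (n + 1), Matrix (Fin (ρ (i + 1))) (Fin (ρ i)) K
  -- A filler: in the charts ρ 0 = 0, so this block has no columns.
  | ⟨0, _⟩ => 0
  | ⟨j + 1, hj⟩ =>
    -- The solution x of x A + (s | A') w = 0, where A and w are the pivot and the lower part of the
    -- preceding columns, and (s | A') completes the current rows.
    -((fromCols (p ⟨j + 1, hj⟩).2 (p.pivot ⟨j + 1, hj⟩) *
      (p ⟨j, j.lt_succ_self.trans hj⟩).1.submatrix Sum.inr id) *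
        (p.pivot ⟨j, j.lt_succ_self.trans hj⟩)⁻¹)

/-- The rows of the differential that meet the pivot. -/
noncomputable def rows (i : Fin (n + 1)) : Matrix (Fin (ρ (i + 1))) (BlockIndex ρ h i) K :=
  fromCols (p.boundaryBlock i) (fromCols (p i).2 (p.pivot i))

/-- The matrices of the differential with coordinates `p`. -/
noncomputable def toMatrix (i : Fin (n + 1)) :
    Matrix (BlockIndex ρ h (i + 1)) (BlockIndex ρ h i) K :=
  (p i).1 * ((p.pivot i)⁻¹ * p.rows i)

theorem toMatrix_submatrix_cols (i : Fin (n + 1)) (hp : (p.pivot i).det ≠ 0) :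
    (p.toMatrix i).submatrix id (Sum.inr ∘ Sum.inr) = (p i).1 := by
  have : (p.toMatrix i).submatrix id (Sum.inr ∘ Sum.inr) = (p i).1 * ((p.pivot i)⁻¹ * p.pivot i) :=
    rfl
  rw [this, nonsing_inv_mul _ hp.isUnit, Matrix.mul_one]

theorem toMatrix_submatrix_rows (i : Fin (n + 1)) (hp : (p.pivot i).det ≠ 0) :
    (p.toMatrix i).submatrix Sum.inl id = p.rows i := by
  have : (p.toMatrix i).submatrix Sum.inl id = p.pivot i * ((p.pivot i)⁻¹ * p.rows i) := rfl
  rw [this, mul_nonsing_inv_cancel_left _ _ hp.isUnit]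

/-- This is the whole content of d² = 0: each matrix has its columns as left factor and its rows as
right factor. -/
theorem rows_mul_cols (j : ℕ) (hj : j + 1 < n + 1)
    (hp : (p.pivot ⟨j, j.lt_succ_self.trans hj⟩).det ≠ 0) :
    p.rows ⟨j + 1, hj⟩ * (p ⟨j, j.lt_succ_self.trans hj⟩).1 = 0 := by
  have : (p ⟨j, j.lt_succ_self.trans hj⟩).1 = fromRows (p.pivot ⟨j, j.lt_succ_self.trans hj⟩)
      ((p ⟨j, j.lt_succ_self.trans hj⟩).1.submatrix Sum.inr id) := by
    ext (i | i) k <;> rfl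
  rw [this, rows, fromCols_mul_fromRows, boundaryBlock, Matrix.neg_mul,
    nonsing_inv_mul_cancel_right _ _ hp.isUnit, neg_add_cancel]

theorem toMatrix_mul_toMatrix (j : ℕ) (hj : j + 1 < n + 1)
    (hp : (p.pivot ⟨j, j.lt_succ_self.trans hj⟩).det ≠ 0) :
    p.toMatrix ⟨j + 1, hj⟩ * p.toMatrix ⟨j, j.lt_succ_self.trans hj⟩ = 0 := by
  rw [toMatrix, toMatrix, Matrix.mul_assoc, Matrix.mul_assoc]
  set Y := (p.pivot ⟨j, j.lt_succ_self.trans hj⟩)⁻¹ * p.rows ⟨j, j.lt_succ_self.trans hj⟩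
  have : p.rows ⟨j + 1, hj⟩ * ((p ⟨j, j.lt_succ_self.trans hj⟩).1 * Y) = 0 := by
    refine (Matrix.mul_assoc _ _ _).symm.trans ?_
    rw [p.rows_mul_cols j hj hp, Matrix.zero_mul]
  refine (congrArg (fun N => (p ⟨j + 1, hj⟩).1 * ((p.pivot ⟨j + 1, hj⟩)⁻¹ * N)) this).trans ?_
  simp only [Matrix.mul_zero]

theorem rank_toMatrix (i : Fin (n + 1)) (hp : (p.pivot i).det ≠ 0) :
    (p.toMatrix i).rank = ρ (i + 1) := by
  refine ((p.toMatrix i).rank_eq_card_of_eq_mul Sum.inl (Sum.inr ∘ Sum.inr) ?_ rfl).trans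
    (Fintype.card_fin _)
  have : (p.toMatrix i).submatrix Sum.inl (Sum.inr ∘ Sum.inr) =
      ((p.toMatrix i).submatrix id (Sum.inr ∘ Sum.inr)).submatrix Sum.inl id := rfl
  rw [this, p.toMatrix_submatrix_cols i hp]
  exact hp

/-- The coordinates of a family of matrices. -/
def ofMatrix (M : ∀ i : Fin (n + 1), Matrix (BlockIndex ρ h (i + 1)) (BlockIndex ρ h i) K) :
    ChartSpace K n ρ h :=
  fun i => ((M i).submatrix id (Sum.inr ∘ Sum.inr), (M i).submatrix Sum.inl (Sum.inr ∘ Sum.inl))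

theorem ofMatrix_toMatrix (hp : ∀ i, (p.pivot i).det ≠ 0) : ofMatrix p.toMatrix = p := by
  funext i
  refine Prod.ext (p.toMatrix_submatrix_cols i (hp i)) ?_
  have : (ofMatrix p.toMatrix i).2 =
      ((p.toMatrix i).submatrix Sum.inl id).submatrix id (Sum.inr ∘ Sum.inl) := rfl
  rw [this, p.toMatrix_submatrix_rows i (hp i)]
  rfl

/-- Here d² = 0 recovers the missing block of the pivot rows, and the rank condition then recovers
the matrix from its pivot rows and columns. -/
theorem toMatrix_ofMatrix
    (M : ∀ i : Fin (n + 1), Matrix (BlockIndex ρ h (i + 1)) (BlockIndex ρ h i) K)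
    (hM : ∀ (j : ℕ) (hj : j + 1 < n + 1), M ⟨j + 1, hj⟩ * M ⟨j, j.lt_succ_self.trans hj⟩ = 0)
    (hrank : ∀ i, (M i).rank = ρ (i + 1)) (hρ : ρ 0 = 0)
    (hp : ∀ i, ((ofMatrix M).pivot i).det ≠ 0) : (ofMatrix M).toMatrix = M := by
  have hrows : ∀ i, (ofMatrix M).rows i = (M i).submatrix Sum.inl id := by
    rintro ⟨_ | j, hj⟩
    · ext a (b | b | b)
      · exact absurd b.2 (by simp [hρ])
      · rfl
      · rfl
    · let A := (ofMatrix M).pivot ⟨j, j.lt_succ_self.trans hj⟩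
      let x := (M ⟨j + 1, hj⟩).submatrix Sum.inl Sum.inl
      let y := (M ⟨j + 1, hj⟩).submatrix Sum.inl Sum.inr
      let w := (M ⟨j, j.lt_succ_self.trans hj⟩).submatrix Sum.inr (Sum.inr ∘ Sum.inr)
      -- The block of the product of consecutive matrices in the pivot rows of the second and the
      -- pivot columns of the first.
      have h0 : x * A + y * w = 0 := by
        have h1 : fromCols x y = (M ⟨j + 1, hj⟩).submatrix Sum.inl id := by
          ext a (b | b) <;> rfl
        have h2 : fromRows A w = (M ⟨j, j.lt_succ_self.trans hj⟩).submatrix id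
            (Sum.inr ∘ Sum.inr) := by
          ext (a | a) b <;> rfl
        rw [← fromCols_mul_fromRows, h1, h2]
        have h3 := congrArg (fun N => N.submatrix Sum.inl (Sum.inr ∘ Sum.inr)) (hM j hj)
        exact h3
      have hy : fromCols ((ofMatrix M) ⟨j + 1, hj⟩).2 ((ofMatrix M).pivot ⟨j + 1, hj⟩) = y := by
        ext a (b | b) <;> rfl
      have hx : (ofMatrix M).boundaryBlock ⟨j + 1, hj⟩ = x := by
        rw [boundaryBlock, hy]
        change -(y * w * A⁻¹) = x
        rw [← eq_neg_iff_add_eq_zero.mpr h0 |> neg_eq_iff_eq_neg.mpr, Matrix.neg_mul, neg_neg]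
        exact mul_nonsing_inv_cancel_right _ _ (hp _).isUnit
      rw [rows, hy, hx]
      ext a (b | b) <;> rfl
  funext i
  rw [toMatrix, hrows]
  exact ((M i).eq_mul_inv_mul_of_rank_eq Sum.inl (Sum.inr ∘ Sum.inr) (hp i)
    ((hrank i).trans (Fintype.card_fin _).symm)).symm

section Regularity

variable (K n ρ h)

theorem entriesMem_fst (i : Fin (n + 1)) :
    EntriesMem (vectorSpacePolynomials K (ChartSpace K n ρ h)) fun p => (p i).1 :=
  fun a b =>
    let φ : Module.Dual K (ChartSpace K n ρ h) :=
      Matrix.entryLinearMap K K a b ∘ₗ LinearMap.fst K _ _ ∘ₗ LinearMap.proj i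
    dual_mem_vectorSpacePolynomials φ

theorem entriesMem_snd (i : Fin (n + 1)) :
    EntriesMem (vectorSpacePolynomials K (ChartSpace K n ρ h)) fun p => (p i).2 :=
  fun a b =>
    let φ : Module.Dual K (ChartSpace K n ρ h) :=
      Matrix.entryLinearMap K K a b ∘ₗ LinearMap.snd K _ _ ∘ₗ LinearMap.proj i
    dual_mem_vectorSpacePolynomials φ

/-- The determinant of the `i`-th pivot as a polynomial function. -/
def pivotDet (i : Fin (n + 1)) : vectorSpacePolynomials K (ChartSpace K n ρ h) :=
  ⟨fun p => (p.pivot i).det, ((entriesMem_fst K n ρ h i).submatrix Sum.inl id).det⟩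

/-- The product of the determinants of all pivots. -/
def pivotDetProd : vectorSpacePolynomials K (ChartSpace K n ρ h) :=
  ∏ i, pivotDet K n ρ h i

variable {K n ρ h} in
theorem pivotDetProd_ne_zero_iff :
    (pivotDetProd K n ρ h).1 p ≠ 0 ↔ ∀ i, (p.pivot i).det ≠ 0 := by
  have : (pivotDetProd K n ρ h).1 p = ∏ i, (p.pivot i).det := by
    simp [pivotDetProd, pivotDet]
  rw [this, Finset.prod_ne_zero_iff]
  simp

theorem entriesMem_toMatrix (i : Fin (n + 1)) :
    EntriesMem (regularFunctions (pivotDetProd K n ρ h)) fun p => p.toMatrix i := by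
  have hle := le_regularFunctions (pivotDetProd K n ρ h)
  have hfst : ∀ i, EntriesMem (regularFunctions (pivotDetProd K n ρ h)) fun p => (p i).1 :=
    fun i a b => hle (entriesMem_fst K n ρ h i a b)
  have hsnd : ∀ i, EntriesMem (regularFunctions (pivotDetProd K n ρ h)) fun p => (p i).2 :=
    fun i a b => hle (entriesMem_snd K n ρ h i a b)
  have hpivot : ∀ i, EntriesMem (regularFunctions (pivotDetProd K n ρ h)) fun p => p.pivot i :=
    fun i => (hfst i).submatrix Sum.inl id
  have hinv : ∀ i, EntriesMem (regularFunctions (pivotDetProd K n ρ h))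
      fun p => (p.pivot i)⁻¹ := fun i => (hpivot i).inv <|
    inv_mem_regularFunctions (f := pivotDet K n ρ h i) (Finset.mul_prod_erase _ _ (Finset.mem_univ i)).symm
  have hblock : ∀ i, EntriesMem (regularFunctions (pivotDetProd K n ρ h))
      fun p => p.boundaryBlock i := by
    rintro ⟨_ | j, hj⟩
    · exact .zero
    · exact ((((hsnd _).fromCols (hpivot _)).mul ((hfst _).submatrix Sum.inr id)).mul (hinv _)).neg
  exact (hfst i).mul ((hinv i).mul ((hblock i).fromCols ((hsnd i).fromCols (hpivot i))))

end Regularity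

end ChartSpace

end ComplexChart

/-! ### The chart attached to bases of the graded pieces -/

section DifferentialChart

variable {K : Type*} [Field K] {n : ℕ} {ρ h : ℕ → ℕ} {V : ℕ → Type*} [∀ i, AddCommGroup (V i)]
  [∀ i, Module K (V i)]

/-- The chart of the variety of differentials given by bases of the graded pieces. -/
noncomputable def differentialChart (hρ : ρ 0 = 0)
    (b : ∀ i, Module.Basis (BlockIndex ρ h i) K (V i)) :
    ZariskiChart K (differentialsOfRank K V fun i : Fin (n + 1) => ρ (i + 1))
      (ChartSpace K n ρ h) where
  coord :=
    { toFun := fun e => ChartSpace.ofMatrix fun i => LinearMap.toMatrix (b i) (b (i + 1)) (e i)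
      map_add' := fun e e' => by
        simp only [Pi.add_apply, map_add]
        rfl
      map_smul' := fun c e => by
        simp only [Pi.smul_apply, map_smul]
        rfl }
  denom := ChartSpace.pivotDetProd K n ρ h
  param := fun p i => Matrix.toLin (b i) (b (i + 1)) (p.toMatrix i)
  dual_param_mem := fun φ => by
    have : (fun p : ChartSpace K n ρ h =>
        φ fun i => Matrix.toLin (b i) (b (i + 1)) (p.toMatrix i)) =
        ∑ i, fun p => (φ ∘ₗ LinearMap.single K _ i ∘ₗ
          (Matrix.toLin (b i) (b (i + 1))).toLinearMap) (p.toMatrix i) := by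
      ext p
      rw [Finset.sum_apply]
      simp only [LinearMap.comp_apply, ← map_sum, LinearEquiv.coe_coe]
      congr 1
      exact (Finset.univ_sum_single _).symm
    rw [this]
    exact Subalgebra.sum_mem _ fun i _ =>
      (ChartSpace.entriesMem_toMatrix K n ρ h i).linearMap_apply _
  param_mem := fun p hp => by
    rw [ChartSpace.pivotDetProd_ne_zero_iff] at hp
    refine ⟨fun j hj => ?_, fun i => ?_⟩
    · refine (Matrix.toLin_mul (b j) (b (j + 1)) (b (j + 1 + 1)) _ _).symm.trans ?_
      rw [p.toMatrix_mul_toMatrix j hj (hp _), map_zero]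
    · rw [← Matrix.rank_eq_finrank_range_toLin]
      exact p.rank_toMatrix i (hp i)
  coord_param := fun p hp => by
    rw [ChartSpace.pivotDetProd_ne_zero_iff] at hp
    simp only [LinearMap.coe_mk, AddHom.coe_mk, LinearMap.toMatrix_toLin]
    exact p.ofMatrix_toMatrix hp
  param_coord := fun z ⟨hz, hrank⟩ hp => by
    rw [ChartSpace.pivotDetProd_ne_zero_iff] at hp
    have := ChartSpace.toMatrix_ofMatrix
      (fun i => LinearMap.toMatrix (b i) (b (i + 1)) (z i)) (fun j hj => ?_) (fun i => ?_) hρ hp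
    · funext i
      refine Eq.trans ?_ (Matrix.toLin_toMatrix (b i) (b (i + 1)) (z i))
      exact congrArg _ (congrFun this i)
    · refine (LinearMap.toMatrix_comp (b j) (b (j + 1)) (b (j + 1 + 1)) _ _).symm.trans ?_
      rw [hz j hj, map_zero]
    · rw [Matrix.rank_eq_finrank_range_toLin _ (b (i + 1)) (b i), Matrix.toLin_toMatrix]
      exact hrank i

/-- A vector killed by the pivot gives an element of the last block whose image is a boundary with
zero first coordinates. By `hrange` that image is 0, so the element is a cycle, and `hker` makes it
trivial. -/
theorem denom_differentialChart_ne_zero (hρ : ρ 0 = 0)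
    (b : ∀ i, Module.Basis (BlockIndex ρ h i) K (V i)) {d : HomShift K n V}
    (hrange : ∀ i, ∀ v ∈ LinearMap.range (d i), (∀ q, (b (i + 1)).repr v (Sum.inl q) = 0) → v = 0)
    (hker : ∀ (i : Fin (n + 1)) (x : Fin (ρ (i + 1)) → K),
      ∑ k, x k • b i (Sum.inr (Sum.inr k)) ∈ LinearMap.ker (d i) → x = 0) :
    (differentialChart (n := n) hρ b).denom.1 ((differentialChart (n := n) hρ b).coord d) ≠ 0 := by
  refine (ChartSpace.pivotDetProd_ne_zero_iff _).mpr fun i hdet => ?_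
  obtain ⟨x, hx0, hx⟩ := Matrix.exists_mulVec_eq_zero_iff.mpr hdet
  refine hx0 (hker i x (LinearMap.mem_ker.mpr (hrange i _ ⟨_, rfl⟩ fun q => ?_)))
  have := congrFun hx q
  simp only [map_sum, map_smul, Finsupp.coe_finsetSum, Finset.sum_apply, Finsupp.smul_apply,
    smul_eq_mul]
  refine Eq.trans (Finset.sum_congr rfl fun k _ => ?_) this
  rw [mul_comm]
  congr 1
  exact (LinearMap.toMatrix_apply (b i) (b (i + 1)) (d i) _ _).symm

end DifferentialChart

/-! ### Boundaries, cycles and the common chart -/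

section Complexes

variable {K : Type*} [Field K] {n : ℕ} {V : ℕ → Type*} [∀ i, AddCommGroup (V i)]
  [∀ i, Module K (V i)]

/-- The boundaries of a differential in all degrees. -/
def boundaries (d : HomShift K n V) : ∀ i : ℕ, Submodule K (V i)
  | 0 => ⊥
  | j + 1 => if hj : j < n + 1 then LinearMap.range (d ⟨j, hj⟩) else ⊥

/-- The cycles of a differential in all degrees. -/
def cycles (d : HomShift K n V) (i : ℕ) : Submodule K (V i) :=
  -- Degree n + 1 matters as the target of dⁿ; no differential leaves it, so everything there is a
  -- cycle.
  if hi : i < n + 1 then LinearMap.ker (d ⟨i, hi⟩) else ⊤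

/-- The vector `(0, r₀, …, rₙ, 0, …)` of the dimensions of the boundaries. -/
def extendRank (r : Fin (n + 1) → ℕ) : ℕ → ℕ
  | 0 => 0
  | j + 1 => if hj : j < n + 1 then r ⟨j, hj⟩ else 0

theorem extendRank_succ (r : Fin (n + 1) → ℕ) (i : Fin (n + 1)) : extendRank r (i + 1) = r i :=
  dif_pos i.2

theorem extendRank_eq_prevEntry (r : Fin (n + 1) → ℕ) (i : Fin (n + 1)) :
    extendRank r i = prevEntry r i := by
  induction i using Fin.cases with
  | zero => rfl
  | succ j =>
    exact extendRank_succ r j.castSucc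

variable {r : Fin (n + 1) → ℕ} {d : HomShift K n V}

theorem boundaries_le_cycles (hd : d ∈ differentialsOfRank K V r) (i : ℕ) :
    boundaries d i ≤ cycles d i := by
  rcases i with _ | j
  · exact bot_le
  · by_cases hj : j + 1 < n + 1
    · simp only [boundaries, cycles, hj, j.lt_succ_self.trans hj, dif_pos]
      exact LinearMap.range_le_ker_iff.mpr (hd.1 j hj)
    · simp only [cycles, hj, dif_neg, not_false_eq_true, le_top]

theorem finrank_boundaries (hd : d ∈ differentialsOfRank K V r) (i : ℕ) :
    Module.finrank K (boundaries d i) = extendRank r i := by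
  rcases i with _ | j
  · exact finrank_bot K _
  · by_cases hj : j < n + 1
    · have h : boundaries d (j + 1) = LinearMap.range (d ⟨j, hj⟩) := dif_pos hj
      have h' : extendRank r (j + 1) = r ⟨j, hj⟩ := dif_pos hj
      rw [h, h']
      exact hd.2 ⟨j, hj⟩
    · have h : boundaries d (j + 1) = ⊥ := dif_neg hj
      have h' : extendRank r (j + 1) = 0 := dif_neg hj
      rw [h, h', finrank_bot]

theorem finrank_cycles_add [∀ i, FiniteDimensional K (V i)] (hd : d ∈ differentialsOfRank K V r)
    (i : ℕ) : Module.finrank K (cycles d i) + extendRank r (i + 1) = Module.finrank K (V i) := by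
  by_cases hi : i < n + 1
  · have h : cycles d i = LinearMap.ker (d ⟨i, hi⟩) := dif_pos hi
    rw [h, extendRank_succ r ⟨i, hi⟩, ← hd.2, add_comm]
    exact LinearMap.finrank_range_add_finrank_ker (d ⟨i, hi⟩)
  · have h : cycles d i = ⊤ := dif_neg hi
    have h' : extendRank r (i + 1) = 0 := dif_neg hi
    rw [h, h', finrank_top, add_zero]

/-- Any two differentials of the same rank lie in a common chart. -/
theorem exists_common_differentialChart [∀ i, FiniteDimensional K (V i)] {h : ℕ → ℕ}
    (hh : ∀ i, extendRank r i + h i + extendRank r (i + 1) = Module.finrank K (V i))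
    {e : HomShift K n V} (hd : d ∈ differentialsOfRank K V r) (he : e ∈ differentialsOfRank K V r) :
    ∃ c : ZariskiChart K (differentialsOfRank K V r) (ChartSpace K n (extendRank r) h),
      c.denom.1 (c.coord d) ≠ 0 ∧ c.denom.1 (c.coord e) ≠ 0 := by
  choose b hbd hbe using fun i => exists_adapted_basis (boundaries_le_cycles hd i)
    (boundaries_le_cycles he i) (finrank_boundaries hd i) (finrank_boundaries he i)
    (finrank_cycles_add hd i) (finrank_cycles_add he i) (hh i)
  have hr : (fun i : Fin (n + 1) => extendRank r (i + 1)) = r := funext (extendRank_succ r)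
  suffices ∃ c : ZariskiChart K (differentialsOfRank K V fun i : Fin (n + 1) => extendRank r (i + 1))
      (ChartSpace K n (extendRank r) h),
      c.denom.1 (c.coord d) ≠ 0 ∧ c.denom.1 (c.coord e) ≠ 0 by rwa [hr] at this
  have hrange : ∀ (d : HomShift K n V) (i : Fin (n + 1)),
      boundaries d (i + 1) = LinearMap.range (d i) := fun d i => dif_pos i.2
  have hker : ∀ (d : HomShift K n V) (i : Fin (n + 1)),
      cycles d i = LinearMap.ker (d i) := fun d i => dif_pos i.2
  refine ⟨differentialChart rfl b, denom_differentialChart_ne_zero rfl b (fun i => ?_) (fun i => ?_),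
    denom_differentialChart_ne_zero rfl b (fun i => ?_) (fun i => ?_)⟩
  · rw [← hrange]
    exact (hbd (i + 1)).1
  · rw [← hker]
    exact (hbd i).2
  · rw [← hrange]
    exact (hbe (i + 1)).1
  · rw [← hker]
    exact (hbe i).2

end Complexes

theorem proposition16 {K : Type*} [Field K] [IsAlgClosed K]
    (n : ℕ) (V : ℕ → Type*) [∀ i, AddCommGroup (V i)] [∀ i, Module K (V i)]
    [∀ i, FiniteDimensional K (V i)]
    (hV : ∀ i, n < i → Subsingleton (V i))
    (r : Fin (n + 1) → ℕ) (hne : (differentialsOfRank K V r).Nonempty) :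
    IsZariskiLocallyClosed K (differentialsOfRank K V r) ∧
    IsZariskiSmooth K (differentialsOfRank K V r) ∧
    IsZariskiIrreducible K (differentialsOfRank K V r) ∧
    ∃ N : ℕ, zariskiDim K (differentialsOfRank K V r) = N ∧
      (N : ℤ) = ∑ i : Fin (n + 1),
        ((Module.finrank K (V i) : ℤ) + (Module.finrank K (V (i + 1)) : ℤ)
          - (r i : ℤ) - (prevEntry r i : ℤ)) * (r i : ℤ) := by
  have : Infinite K := IsAlgClosed.instInfinite
  obtain ⟨d, hd⟩ := hne
  -- h i is the dimension of the homology in degree i; it depends only on r and V, so all charts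
  -- share one coordinate space.
  have hle : ∀ i, ∃ h, extendRank r i + h + extendRank r (i + 1) = Module.finrank K (V i) := by
    intro i
    have h1 := Submodule.finrank_mono (boundaries_le_cycles hd i)
    have h2 := finrank_boundaries hd i
    have h3 := finrank_cycles_add hd i
    exact ⟨Module.finrank K (V i) - extendRank r i - extendRank r (i + 1), by omega⟩
  choose h hh using hle
  obtain ⟨h1, h2, h3, h4⟩ := smooth_irreducible_of_common_charts ⟨d, hd⟩
    fun x hx y hy => exists_common_differentialChart hh hx hy
  refine ⟨h1, h2, h3, _, h4, ?_⟩
  simp only [Module.finrank_pi_fintype, Module.finrank_prod, Module.finrank_matrix,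
    Module.finrank_self, mul_one, Fintype.card_sum, Fintype.card_fin]
  push_cast
  refine Finset.sum_congr rfl fun i _ => ?_
  -- The i-th factor of the chart space has dimension (vᵢ₊₁ + hᵢ) rᵢ, with hᵢ = vᵢ − rᵢ₋₁ − rᵢ.
  rw [← hh i, ← hh (i + 1), ← extendRank_eq_prevEntry, extendRank_succ]
  push_cast
  ring
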